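/- Let $p\ge 5$, $2\le r\le p-3$ and $k\ge 0$ be integers, let $0<\tau_1<\dots<\tau_k<1$, and put $n=p+1+k(p-r)$. Let $N_0,\dots,N_{n-1}$ be the B-splines of degree $p$ on $[0,1]$ for the open knot vector in which $0$ and $1$ have multiplicity $p+1$ and every $\tau_m$ has multiplicity $p-r$; let $\mathcal S$ be their span, let $N_{i,j}(u,v)=N_i(u)N_j(v)$, and let $\mathcal S\otimes\mathcal S$ be the tensor-product spline space on $[0,1]^2$. Let $F^{(L)},F^{(R)}:[0,1]^2\to\mathbb R^2$ be injective, with both coordinates in $\mathcal S\otimes\mathcal S$ and with Jacobian determinant nonzero at every point of $[0,1]^2$. Let $\Omega^{(S)}=F^{(S)}([0,1]^2)$ for $S\in\{L,R\}$ and $\Omega=\Omega^{(L)}\cup\Omega^{(R)}$, and assume that $F^{(L)}(0,v)=F^{(R)}(0,v)$ for all $v\in[0,1]$ and $\Omega^{(L)}\cap\Omega^{(R)}=F^{(L)}(\{0\}\times[0,1])$. Assume that $(F^{(L)},F^{(R)})$ is bilinear-like $G^2$: there are polynomials $\alpha^{(L)},\alpha^{(R)},\beta^{(L)},\beta^{(R)}$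 in $v$ of degree at most $1$ such that, with $\beta=\alpha^{(L)}\beta^{(R)}-\alpha^{(R)}\beta^{(L)}$, for all $v\in[0,1]$ one has $\alpha^{(L)}(v)\alpha^{(R)}(v)<0$ and, at the points $(0,v)$, $$\alpha^{(R)}D_uF^{(L)}-\alpha^{(L)}D_uF^{(R)}+\beta D_vF^{(L)}=0,\qquad \alpha^{(L)}Z+\eta\, D_uF^{(L)}+\theta\, D_vF^{(L)}=0,$$ where $$Z=(\alpha^{(L)})^2D_{uu}F^{(R)}-\big((\alpha^{(R)})^2D_{uu}F^{(L)}+2\alpha^{(R)}\beta D_{uv}F^{(L)}+\beta^2D_{vv}F^{(L)}\big),$$ $$\eta=2(\alpha^{(L)})'\alpha^{(R)}\beta,\qquad \theta=2\big(\alpha^{(L)}(\beta^{(L)})'-(\alpha^{(L)})'\beta^{(L)}\big)\alpha^{(R)}\beta.$$ Let $\mathcal V^2$ be the space of all $\phi\in C^2(\Omega)$ such that $\phi\circ F^{(S)}\in\mathcal S\otimes\mathcal S$ for $S\in\{L,R\}$, with spline representations $\phi\circ F^{(S)}=\sum_{i,j=0}^{n-1}d^{(S)}_{i,j}N_{i,j}$,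 and let $$\mathcal V_1^2=\{\phi\in\mathcal V^2 : d^{(S)}_{i,j}=0\text{ for } S\in\{L,R\},\ i=0,1,2,\ j=0,\dots,n-1\}.$$ Then $$\dim\mathcal V_1^2=2\,(p-2+k(p-r))\,(p+1+k(p-r)),$$ and a basis of $\mathcal V_1^2$ is given by the functions $\phi^{(L)}_{i,j}$ and $\phi^{(R)}_{i,j}$, $i=3,\dots,p+k(p-r)$, $j=0,\dots,p+k(p-r)$, which are determined by $$\phi^{(L)}_{i,j}\circ F^{(L)}=N_{i,j},\quad \phi^{(L)}_{i,j}\circ F^{(R)}=0,\qquad \phi^{(R)}_{i,j}\circ F^{(L)}=0,\quad \phi^{(R)}_{i,j}\circ F^{(R)}=N_{i,j}.$$ -/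

import Mathlib

namespace Iso

open Set Polynomial

noncomputable section

/-- The open knot vector: `0` with multiplicity `p + 1`, each inner knot `τ m` with
multiplicity `p - r`, then `1`.  Only the indices `0, …, 2 * p + 1 + k * (p - r)` matter. -/
def knot (p r : ℕ) {k : ℕ} (τ : Fin k → ℝ) (i : ℕ) : ℝ :=
  if i ≤ p then 0
  else if h : (i - (p + 1)) / (p - r) < k then τ ⟨(i - (p + 1)) / (p - r), h⟩
  else 1

/-- The `i`-th B-spline of degree `d` for the knots `t` on `[0, 1]`, by the Cox–de Boor recursion
with the convention `x / 0 = 0`.  The last nonempty knot span is closed on the right, so that the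
B-splines are continuous from the left at the end point `1`. -/
def bspline (t : ℕ → ℝ) : ℕ → ℕ → ℝ → ℝ
  | 0, i, x =>
      open Classical in
      if (t i ≤ x ∧ x < t (i + 1)) ∨ (x = 1 ∧ t i < 1 ∧ t (i + 1) = 1) then 1 else 0
  | d + 1, i, x =>
      (x - t i) / (t (i + d + 1) - t i) * bspline t d i x +
        (t (i + d + 2) - x) / (t (i + d + 2) - t (i + 1)) * bspline t d (i + 1) x

/-- The B-splines `N_i`, `i = 0, …, p + k * (p - r)`, as functions on `[0, 1]`. -/
def N (p r : ℕ) {k : ℕ} (τ : Fin k → ℝ) (i : Fin (p + 1 + k * (p - r))) :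
    unitInterval → ℝ :=
  fun x => bspline (knot p r τ) p i (x : ℝ)

/-- The tensor-product B-splines `N_{i,j}(u, v) = N_i(u) N_j(v)` on `[0, 1]²`. -/
def NN (p r : ℕ) {k : ℕ} (τ : Fin k → ℝ) (i j : Fin (p + 1 + k * (p - r))) :
    unitInterval × unitInterval → ℝ :=
  fun q => N p r τ i q.1 * N p r τ j q.2

/-- The univariate spline space on `[0, 1]`, spanned by the B-splines. -/
def splineSpace (p r : ℕ) {k : ℕ} (τ : Fin k → ℝ) : Submodule ℝ (unitInterval → ℝ) :=
  Submodule.span ℝ (range (N p r τ))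

/-- The tensor product of the univariate spline space with itself, as a space of functions on
`[0, 1]²`. -/
def splineSpace₂ (p r : ℕ) {k : ℕ} (τ : Fin k → ℝ) :
    Submodule ℝ (unitInterval × unitInterval → ℝ) :=
  Submodule.span ℝ {h | ∃ f ∈ splineSpace p r τ, ∃ g ∈ splineSpace p r τ,
    h = fun q => f q.1 * g q.2}

/-- The derivative of a function on `[0, 1]` (one-sided at the end points). -/
def derivI {E : Type*} [NormedAddCommGroup E] [NormedSpace ℝ E] (f : unitInterval → E)
    (x : unitInterval) : E :=
  derivWithin (IccExtend (zero_le_one : (0 : ℝ) ≤ 1) f) (Icc 0 1) (x : ℝ)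

/-- The partial derivative with respect to the first variable `u`. -/
def Du {E : Type*} [NormedAddCommGroup E] [NormedSpace ℝ E]
    (g : unitInterval × unitInterval → E) : unitInterval × unitInterval → E :=
  fun q => derivI (fun u => g (u, q.2)) q.1

/-- The partial derivative with respect to the second variable `v`. -/
def Dv {E : Type*} [NormedAddCommGroup E] [NormedSpace ℝ E]
    (g : unitInterval × unitInterval → E) : unitInterval × unitInterval → E :=
  fun q => derivI (fun v => g (q.1, v)) q.2

/-- The two patches: left and right. -/
inductive Side
  | L
  | R
  deriving DecidableEq

/-- The two-patch domain `Ω`, the union of the images of the two geometry mappings. -/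
def domain (F : Side → unitInterval × unitInterval → ℝ × ℝ) : Set (ℝ × ℝ) :=
  range (F Side.L) ∪ range (F Side.R)

theorem mem_domain (F : Side → unitInterval × unitInterval → ℝ × ℝ) (S : Side)
    (q : unitInterval × unitInterval) : F S q ∈ domain F := by
  cases S
  · exact Or.inl ⟨q, rfl⟩
  · exact Or.inr ⟨q, rfl⟩

/-- A two-patch parameterization: two regular, bijective spline geometry mappings onto their
images, which meet exactly in the common edge `u = 0`, parameterized in the same way. -/
structure IsTwoPatch (p r : ℕ) {k : ℕ} (τ : Fin k → ℝ)
    (F : Side → unitInterval × unitInterval → ℝ × ℝ) : Prop where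
  spline_fst : ∀ S, (fun q => (F S q).1) ∈ splineSpace₂ p r τ
  spline_snd : ∀ S, (fun q => (F S q).2) ∈ splineSpace₂ p r τ
  injective : ∀ S, Function.Injective (F S)
  regular : ∀ S q, (Du (F S) q).1 * (Dv (F S) q).2 - (Du (F S) q).2 * (Dv (F S) q).1 ≠ 0
  edge : ∀ v, F Side.L (0, v) = F Side.R (0, v)
  interface : range (F Side.L) ∩ range (F Side.R) = range fun v => F Side.L (0, v)

/-- Bilinear-like `G²`: there are linear polynomials `α^(S)`, `β^(S)` such that, with
`β = α^(L) β^(R) - α^(R) β^(L)`, the first and second order matching conditions of the geometry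
mappings along the interface hold in the form known from bilinear patches. -/
def IsBilinearLikeG2 (F : Side → unitInterval × unitInterval → ℝ × ℝ) : Prop :=
  ∃ a b : Side → ℝ[X], (∀ S, (a S).natDegree ≤ 1) ∧ (∀ S, (b S).natDegree ≤ 1) ∧
    ∀ v : unitInterval,
      let aL := (a Side.L).eval (v : ℝ)
      let aR := (a Side.R).eval (v : ℝ)
      let bL := (b Side.L).eval (v : ℝ)
      let bR := (b Side.R).eval (v : ℝ)
      let daL := (derivative (a Side.L)).eval (v : ℝ)
      let dbL := (derivative (b Side.L)).eval (v : ℝ)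
      let β := aL * bR - aR * bL
      let FL := F Side.L
      let FR := F Side.R
      let Z := aL ^ 2 • Du (Du FR) (0, v) -
        (aR ^ 2 • Du (Du FL) (0, v) + (2 * aR * β) • Dv (Du FL) (0, v) +
          β ^ 2 • Dv (Dv FL) (0, v))
      let η := 2 * daL * aR * β
      let θ := 2 * (aL * dbL - daL * bL) * aR * β
      aL * aR < 0 ∧
      FL (0, v) = FR (0, v) ∧
      aR • Du FL (0, v) - aL • Du FR (0, v) + β • Dv FL (0, v) = 0 ∧
      aL • Z + η • Du FL (0, v) + θ • Dv FL (0, v) = 0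

/-- The pullback `g^(S) = φ ∘ F^(S)` of a function on the two-patch domain. -/
def pullback (F : Side → unitInterval × unitInterval → ℝ × ℝ) (φ : domain F → ℝ) (S : Side) :
    unitInterval × unitInterval → ℝ :=
  fun q => φ ⟨F S q, mem_domain F S q⟩

/-- The space `𝒱` of isogeometric functions on `Ω`. -/
def isoSpace (p r : ℕ) {k : ℕ} (τ : Fin k → ℝ)
    (F : Side → unitInterval × unitInterval → ℝ × ℝ) : Submodule ℝ (domain F → ℝ) where
  carrier := {φ | ∀ S, pullback F φ S ∈ splineSpace₂ p r τ}
  add_mem' := fun hφ hψ S => (splineSpace₂ p r τ).add_mem (hφ S) (hψ S)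
  zero_mem' := fun _ => (splineSpace₂ p r τ).zero_mem
  smul_mem' := fun c _ hφ S => (splineSpace₂ p r τ).smul_mem c (hφ S)

/-- The space `C^s(Ω)` of functions on a subset `Ω` of the plane that are `s` times continuously
differentiable on `Ω`. -/
def smoothSpace (s : ℕ) (Ω : Set (ℝ × ℝ)) : Submodule ℝ (Ω → ℝ) where
  carrier := {φ | ∃ f : ℝ × ℝ → ℝ, ContDiffOn ℝ s f Ω ∧ ∀ x : Ω, φ x = f x}
  add_mem' := by
    rintro φ ψ ⟨f, hf, hφ⟩ ⟨g, hg, hψ⟩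
    exact ⟨fun x => f x + g x, hf.add hg, fun x => by simp [hφ x, hψ x]⟩
  zero_mem' := ⟨fun _ => 0, contDiffOn_const, fun _ => rfl⟩
  smul_mem' := by
    rintro c φ ⟨f, hf, hφ⟩
    exact ⟨fun x => c • f x, hf.const_smul c, fun x => by simp [hφ x]⟩

/-- The space `𝒱^s = 𝒱 ∩ C^s(Ω)` of `C^s`-smooth isogeometric functions. -/
def smoothIsoSpace (p r : ℕ) {k : ℕ} (τ : Fin k → ℝ)
    (F : Side → unitInterval × unitInterval → ℝ × ℝ) (s : ℕ) : Submodule ℝ (domain F → ℝ) :=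
  isoSpace p r τ F ⊓ smoothSpace s (domain F)

/-- The space `𝒱₁²` of `C²`-smooth isogeometric functions whose spline coefficients
`d_{i,j}^(S)` vanish for `i = 0, 1, 2`. -/
def isoSpaceOne (p r : ℕ) {k : ℕ} (τ : Fin k → ℝ)
    (F : Side → unitInterval × unitInterval → ℝ × ℝ) : Submodule ℝ (domain F → ℝ) where
  carrier := {φ | φ ∈ smoothIsoSpace p r τ F 2 ∧
    ∀ S, ∃ d : Fin (p + 1 + k * (p - r)) → Fin (p + 1 + k * (p - r)) → ℝ,
      (∀ q, pullback F φ S q = ∑ i, ∑ j, d i j * NN p r τ i j q) ∧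
      ∀ i j : Fin (p + 1 + k * (p - r)), (i : ℕ) ≤ 2 → d i j = 0}
  add_mem' := by
    rintro φ ψ ⟨hφ, hφd⟩ ⟨hψ, hψd⟩
    refine ⟨add_mem hφ hψ, fun S => ?_⟩
    obtain ⟨d, hd, hd0⟩ := hφd S
    obtain ⟨e, he, he0⟩ := hψd S
    refine ⟨fun i j => d i j + e i j, fun q => ?_, fun i j hi => by simp [hd0 i j hi, he0 i j hi]⟩
    have h : pullback F (φ + ψ) S q = pullback F φ S q + pullback F ψ S q := rfl
    rw [h, hd, he]
    simp only [add_mul, Finset.sum_add_distrib]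
  zero_mem' := ⟨zero_mem _, fun S => ⟨fun _ _ => 0, fun q => by simp [pullback], fun _ _ _ => rfl⟩⟩
  smul_mem' := by
    rintro c φ ⟨hφ, hφd⟩
    refine ⟨Submodule.smul_mem _ c hφ, fun S => ?_⟩
    obtain ⟨d, hd, hd0⟩ := hφd S
    refine ⟨fun i j => c * d i j, fun q => ?_, fun i j hi => by simp [hd0 i j hi]⟩
    have h : pullback F (c • φ) S q = c * pullback F φ S q := rfl
    rw [h, hd]
    simp only [Finset.mul_sum, mul_assoc]

end

end Iso

/-! ### Polynomial pieces of B-splines: smoothness across knots, order of vanishing. -/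

namespace Iso

open Set Polynomial

/-! A function on `Ω` is determined by its two pullbacks. If each function with pullback `N_{i,j}`
(`i ≥ 3`) on one patch and `0` on the other lies in `𝒱₁²`, these functions therefore span: any
element of `𝒱₁²` has pullbacks using only the indices `i ≥ 3`. They are independent because the
tensor-product B-splines are. The dimension is then a count of indices.

The substance is that these functions are `C²` on `Ω`, also across the interface. At `u = 0`, `N_i`
vanishes to order at least `3`, so the pullback is `u³ g` with `g` of class `C²`
(`IsOpenKnots.exists_bspline_eq_pow_mul`). Differentiating `f ∘ F = u^(m+1) g` and composing with
the inverse of `DF` gives `Df ∘ F = u^m h` with `h` one class less smooth. Each derivative thus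
still vanishes on the interface and extends by zero to the other patch; induction on `m` gives
`contDiffOn_image_union`.

The B-spline facts come from the polynomial pieces. Adjacent pieces at a knot of multiplicity `m`
differ by a multiple of a high power of `X - x`, which gives smoothness. On a fixed span, the pieces
of the B-splines starting at its left knot vanish there to strictly increasing orders, which gives
independence. -/

/-- The Cox–de Boor recursion in `ℝ[X]` started from the indicator of the knot span `j`: on that
span it is the polynomial piece of the `i`-th B-spline of degree `d`. -/
noncomputable def spanPoly (t : ℕ → ℝ) (j : ℕ) : ℕ → ℕ → ℝ[X]
  | 0, i => if i = j then 1 else 0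
  | d + 1, i =>
      C (t (i + d + 1) - t i)⁻¹ * (X - C (t i)) * spanPoly t j d i +
        C (t (i + d + 2) - t (i + 1))⁻¹ * (C (t (i + d + 2)) - X) * spanPoly t j d (i + 1)

theorem spanPoly_zero (t : ℕ → ℝ) (j i : ℕ) : spanPoly t j 0 i = if i = j then 1 else 0 := rfl

theorem spanPoly_succ (t : ℕ → ℝ) (j d i : ℕ) :
    spanPoly t j (d + 1) i =
      C (t (i + d + 1) - t i)⁻¹ * (X - C (t i)) * spanPoly t j d i +
        C (t (i + d + 2) - t (i + 1))⁻¹ * (C (t (i + d + 2)) - X) * spanPoly t j d (i + 1) := rfl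

theorem spanPoly_eq_zero_of_lt (t : ℕ → ℝ) {j : ℕ} (d : ℕ) :
    ∀ {i : ℕ}, j < i → spanPoly t j d i = 0 := by
  induction d with
  | zero => intro i h; simp [spanPoly_zero, h.ne']
  | succ d ih => intro i h; simp [spanPoly_succ, ih h, ih (h.trans (Nat.lt_succ_self i))]

theorem bspline_eq_eval_spanPoly (t : ℕ → ℝ) (j : ℕ) (x : ℝ)
    (h : ∀ i, ((t i ≤ x ∧ x < t (i + 1)) ∨ (x = 1 ∧ t i < 1 ∧ t (i + 1) = 1)) ↔ i = j) (d : ℕ) :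
    ∀ i, bspline t d i x = (spanPoly t j d i).eval x := by
  induction d with
  | zero =>
    intro i
    rw [spanPoly_zero, bspline]
    by_cases hi : i = j
    · rw [if_pos ((h i).2 hi), if_pos hi, eval_one]
    · rw [if_neg (fun h' => hi ((h i).1 h')), if_neg hi, eval_zero]
  | succ d ih =>
    intro i
    rw [spanPoly_succ, bspline, ih, ih]
    simp only [eval_add, eval_mul, eval_sub, eval_C, eval_X]
    ring

/-- The usual degree-lowering formula, obtained by differentiating the recursion and inducting on
the degree. It makes smoothness across knots an induction on the order of the derivative. -/
theorem derivative_spanPoly_succ {t : ℕ → ℝ} (ht : Monotone t) (j d : ℕ) :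
    ∀ i, derivative (spanPoly t j (d + 1) i) =
      C ((d : ℝ) + 1) * (C (t (i + d + 1) - t i)⁻¹ * spanPoly t j d i -
        C (t (i + d + 2) - t (i + 1))⁻¹ * spanPoly t j d (i + 1)) := by
  induction d with
  | zero =>
    intro i
    rw [spanPoly_succ, spanPoly_zero, spanPoly_zero]
    split_ifs <;> simp [sub_eq_add_neg]
  | succ d ih =>
    intro i
    -- With `0⁻¹ = 0` the cancellation `a⁻¹ * a = 1` may fail on a degenerate knot interval; but
    -- then every subinterval is degenerate too, so the identity survives after multiplying by its
    -- inverse length.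
    have key : ∀ i, (t (i + (d + 2)) - t i)⁻¹ * (t (i + (d + 2)) - t i) *
        (t (i + (d + 2)) - t (i + 1))⁻¹ = (t (i + (d + 2)) - t (i + 1))⁻¹ ∧
        (t (i + (d + 2)) - t i)⁻¹ * (t (i + (d + 2)) - t i) *
        (t (i + (d + 1)) - t i)⁻¹ = (t (i + (d + 1)) - t i)⁻¹ := by
      intro i
      have h1 := ht (show i ≤ i + 1 by omega)
      have h2 := ht (show i + 1 ≤ i + (d + 2) by omega)
      have h3 := ht (show i ≤ i + (d + 1) by omega)
      have h4 := ht (show i + (d + 1) ≤ i + (d + 2) by omega)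
      by_cases h : t (i + (d + 2)) - t i = 0
      · rw [show t (i + (d + 2)) - t (i + 1) = 0 by linarith,
          show t (i + (d + 1)) - t i = 0 by linarith]
        simp
      · simp [inv_mul_cancel₀ h]
    have k1 := congrArg C (key i).1
    have k2 := congrArg C (key (i + 1)).2
    rw [spanPoly_succ t j (d + 1)]
    simp only [derivative_add, derivative_mul, derivative_sub, derivative_C, derivative_X, ih]
    simp only [spanPoly_succ]
    simp only [show i + (d + 1) + 1 = i + (d + 2) by omega, show i + d + 1 = i + (d + 1) by omega,
      show i + d + 2 = i + (d + 2) by omega, show i + (d + 1) + 2 = i + 1 + (d + 2) by omega,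
      show i + 1 + d + 1 = i + (d + 2) by omega, show i + 1 + (d + 1) = i + (d + 2) by omega,
      show i + 1 + d + 2 = i + 1 + (d + 2) by omega, show i + 1 + 1 = i + 2 by omega] at k1 k2 ⊢
    simp only [C_mul, C_sub, C_add, C_1, Nat.cast_add, Nat.cast_one] at k1 k2 ⊢
    linear_combination (C (d : ℝ) + 1) * spanPoly t j d (i + 1) * (k2 - k1)

/-- To the left of a knot `τ = t (a + 1) = ⋯ = t (a + m)`. -/
theorem eval_spanPoly_left {t : ℕ → ℝ} {a m : ℕ} {x : ℝ} (ha : t a < x)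
    (hm : ∀ l, 1 ≤ l → l ≤ m → t (a + l) = x) :
    ∀ d ≤ m, ∀ i, (spanPoly t a d i).eval x = if i = a then 1 else 0 := by
  intro d
  induction d with
  | zero => intro _ i; rw [spanPoly_zero]; split_ifs <;> simp
  | succ d ih =>
    intro hd i
    rw [spanPoly_succ]
    simp only [eval_add, eval_mul, eval_sub, eval_C, eval_X, ih (by omega)]
    rcases eq_or_ne i a with rfl | hi
    · have := hm (d + 1) (by omega) hd
      rw [if_pos rfl, if_neg (by omega), show i + d + 1 = i + (d + 1) by omega, this,
        inv_mul_cancel₀ (by linarith)]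
      ring
    · rw [if_neg hi]
      rcases eq_or_ne (i + 1) a with h | h
      · rw [if_pos h, show i + d + 2 = a + (d + 1) by omega, hm (d + 1) (by omega) hd]
        ring
      · rw [if_neg h]; ring

/-- To the right of a knot `τ = t (a + 1) = ⋯ = t (a + m)`. -/
theorem eval_spanPoly_right {t : ℕ → ℝ} {a m : ℕ} {x : ℝ} (hb : x < t (a + m + 1))
    (hm : ∀ l, 1 ≤ l → l ≤ m → t (a + l) = x) :
    ∀ d ≤ m, ∀ i, (spanPoly t (a + m) d i).eval x = if i + d = a + m then 1 else 0 := by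
  intro d
  induction d with
  | zero => intro _ i; rw [spanPoly_zero]; simp only [add_zero]; split_ifs <;> simp
  | succ d ih =>
    intro hd i
    rw [spanPoly_succ]
    simp only [eval_add, eval_mul, eval_sub, eval_C, eval_X, ih (by omega)]
    rcases eq_or_ne (i + d + 1) (a + m) with h | h
    · have := hm (m - d) (by omega) (by omega)
      rw [if_neg (by omega), if_pos (by omega), if_pos (by omega),
        show i + d + 2 = a + m + 1 by omega, show i + 1 = a + (m - d) by omega, this,
        inv_mul_cancel₀ (by linarith)]
      ring
    · rw [if_neg (show ¬ i + 1 + d = a + m by omega), if_neg (show ¬ i + (d + 1) = a + m by omega)]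
      rcases eq_or_ne (i + d) (a + m) with h' | h'
      · rw [show i = a + (m - d) by omega, hm (m - d) (by omega) (by omega)]
        ring
      · rw [if_neg h']; ring

/-- At degree exactly `m` both one-sided values are the indicator of `i = a`. Above that, both sides
obey the same recursion. -/
theorem eval_spanPoly_left_eq_right {t : ℕ → ℝ} {a m : ℕ} {x : ℝ} (ha : t a < x)
    (hb : x < t (a + m + 1)) (hm : ∀ l, 1 ≤ l → l ≤ m → t (a + l) = x) {d : ℕ} (hd : m ≤ d) :
    ∀ i, (spanPoly t a d i).eval x = (spanPoly t (a + m) d i).eval x := by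
  induction d, hd using Nat.le_induction with
  | base =>
    intro i
    rw [eval_spanPoly_left ha hm m le_rfl, eval_spanPoly_right hb hm m le_rfl]
    simp
  | succ d hd ih =>
    intro i
    simp only [spanPoly_succ, eval_add, eval_mul, ih]

/-- Each derivative lowers the degree by one and turns a difference of pieces into a combination of
such differences, so continuity at degree at least `m` can be used `d - m` further times. -/
theorem eval_iterate_derivative_spanPoly_sub {t : ℕ → ℝ} (ht : Monotone t) {a m : ℕ} {x : ℝ}
    (ha : t a < x) (hb : x < t (a + m + 1)) (hm : ∀ l, 1 ≤ l → l ≤ m → t (a + l) = x) (l : ℕ) :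
    ∀ d, l + m ≤ d → ∀ i,
      (derivative^[l] (spanPoly t a d i - spanPoly t (a + m) d i)).eval x = 0 := by
  induction l with
  | zero =>
    intro d hd i
    simp [eval_spanPoly_left_eq_right ha hb hm (show m ≤ d by omega) i]
  | succ l ih =>
    intro d hd i
    obtain ⟨d, rfl⟩ : ∃ e, d = e + 1 := ⟨d - 1, by omega⟩
    have h1 := ih d (by omega) i
    have h2 := ih d (by omega) (i + 1)
    have : derivative (spanPoly t a (d + 1) i - spanPoly t (a + m) (d + 1) i) =
        C (((d : ℝ) + 1) * (t (i + d + 1) - t i)⁻¹) *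
          (spanPoly t a d i - spanPoly t (a + m) d i) -
        C (((d : ℝ) + 1) * (t (i + d + 2) - t (i + 1))⁻¹) *
          (spanPoly t a d (i + 1) - spanPoly t (a + m) d (i + 1)) := by
      rw [derivative_sub, derivative_spanPoly_succ ht, derivative_spanPoly_succ ht]
      simp only [C_mul]
      ring
    rw [Function.iterate_succ_apply, this, iterate_derivative_sub, iterate_derivative_C_mul,
      iterate_derivative_C_mul, eval_sub, eval_mul, eval_mul, h1, h2]
    simp

theorem X_sub_C_pow_dvd_spanPoly_sub {t : ℕ → ℝ} (ht : Monotone t) {a m : ℕ} {x : ℝ}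
    (ha : t a < x) (hb : x < t (a + m + 1)) (hm : ∀ l, 1 ≤ l → l ≤ m → t (a + l) = x)
    {n d : ℕ} (hd : n + m ≤ d) (i : ℕ) :
    (X - C x) ^ (n + 1) ∣ spanPoly t a d i - spanPoly t (a + m) d i := by
  by_cases h0 : spanPoly t a d i - spanPoly t (a + m) d i = 0
  · rw [h0]; exact dvd_zero _
  · exact (le_rootMultiplicity_iff h0).1 ((lt_rootMultiplicity_iff_isRoot_iterate_derivative h0).2
      fun l hl => eval_iterate_derivative_spanPoly_sub ht ha hb hm l d (by omega) i)

/-- The exact order of vanishing of the pieces of a B-spline at its first knot. -/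
theorem exists_spanPoly_eq_pow_mul {t : ℕ → ℝ} (ht : Monotone t) {b : ℕ} (hb : t b < t (b + 1))
    (d : ℕ) : ∀ i, i ≤ b → b ≤ i + d → t i = t b →
      ∃ S : ℝ[X], spanPoly t b d i = (X - C (t b)) ^ (i + d - b) * S ∧ 0 < S.eval (t b) := by
  induction d with
  | zero =>
    intro i h1 h2 _
    obtain rfl : i = b := by omega
    exact ⟨1, by simp [spanPoly_zero], by simp⟩
  | succ d ih =>
    intro i h1 h2 hi
    have hpos : ∀ l, b + 1 ≤ l → t b < t l := fun l hl => hb.trans_le (ht hl)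
    have hinv : ∀ l, b + 1 ≤ l → 0 < (t l - t b)⁻¹ := fun l hl =>
      inv_pos.2 (sub_pos.2 (hpos l hl))
    have hi1 : i < b → t (i + 1) = t b := fun h =>
      le_antisymm (ht h) (hi ▸ ht (Nat.le_succ i))
    -- The shifted B-spline also starts at `t b` and contributes the same order of vanishing as the
    -- first summand. Tracking positivity, not just nonvanishing, of `S` at `t b` rules out
    -- cancellation between the two.
    have second : i < b → ∃ S : ℝ[X], C (t (i + d + 2) - t (i + 1))⁻¹ * (C (t (i + d + 2)) - X) *
        spanPoly t b d (i + 1) = (X - C (t b)) ^ (i + (d + 1) - b) * S ∧ 0 < S.eval (t b) := by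
      intro h
      obtain ⟨S, hS, hS0⟩ := ih (i + 1) h (by omega) (hi1 h)
      refine ⟨C (t (i + d + 2) - t (i + 1))⁻¹ * (C (t (i + d + 2)) - X) * S, ?_, ?_⟩
      · rw [hS, show i + 1 + d - b = i + (d + 1) - b by omega]; ring
      · simp only [eval_mul, eval_C, eval_sub, eval_X, hi1 h]
        exact mul_pos (mul_pos (hinv _ (by omega)) (sub_pos.2 (hpos _ (by omega)))) hS0
    -- In the case of equality the exponent is `0`, and the factor `X - C (t i)` already kills the
    -- first summand at `t b = t i`.
    rcases eq_or_ne b (i + d + 1) with h | h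
    · obtain ⟨S, hS, hS0⟩ := second (by omega)
      refine ⟨C (t (i + d + 1) - t i)⁻¹ * (X - C (t i)) * spanPoly t b d i + S, ?_, ?_⟩
      · rw [spanPoly_succ, hS, show i + (d + 1) - b = 0 by omega]; ring
      · simp [hi, hS0]
    · obtain ⟨S, hS, hS0⟩ := ih i h1 (by omega) hi
      have e : i + (d + 1) - b = i + d - b + 1 := by omega
      have hfst : 0 < (C (t (i + d + 1) - t i)⁻¹ * S).eval (t b) := by
        rw [eval_mul, eval_C, hi]
        exact mul_pos (hinv _ (by omega)) hS0
      rcases h1.eq_or_lt with h' | h'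
      · refine ⟨C (t (i + d + 1) - t i)⁻¹ * S, ?_, hfst⟩
        rw [spanPoly_succ, spanPoly_eq_zero_of_lt t d (show b < i + 1 by omega), hS, e, hi]
        ring
      · obtain ⟨S', hS', hS0'⟩ := second h'
        refine ⟨C (t (i + d + 1) - t i)⁻¹ * S + S', ?_, ?_⟩
        · rw [spanPoly_succ, hS', hS, e, hi]; ring
        · rw [eval_add]; exact add_pos hfst hS0'

end Iso

/-! ### Smooth extension by zero across a closed set. -/

namespace Iso

open Set Polynomial

theorem continuousOn_of_leftInvOn_of_isCompact {E E' : Type*} [TopologicalSpace E]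
    [TopologicalSpace E'] [T2Space E'] {Q : Set E} (hQ : IsCompact Q) {F : E → E'} {G : E' → E}
    (hF : ContinuousOn F Q) (hG : LeftInvOn G F Q) : ContinuousOn G (F '' Q) := by
  rw [continuousOn_iff_isClosed]
  intro s hs
  refine ⟨F '' (Q ∩ s), ((hQ.inter_right hs).image_of_continuousOn
    (hF.mono inter_subset_left)).isClosed, ?_⟩
  ext y
  constructor
  · rintro ⟨hy, q, hq, rfl⟩
    rw [mem_preimage, hG hq] at hy
    exact ⟨⟨q, ⟨hq, hy⟩, rfl⟩, ⟨q, hq, rfl⟩⟩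
  · rintro ⟨⟨q, ⟨hq, hs⟩, rfl⟩, h⟩
    exact ⟨by rw [mem_preimage, hG hq]; exact hs, h⟩

/-- On the image, `f` is `w ∘ I`, and the continuous left inverse `I` has derivative `A⁻¹` within
the image. Openness of the image is not needed. -/
theorem hasFDerivWithinAt_comp_leftInvOn {E G : Type*} [NormedAddCommGroup E]
    [NormedSpace ℝ E] [NormedAddCommGroup G] [NormedSpace ℝ G]
    {Q : Set E} {F : E → E} {I : E → E} (hI : LeftInvOn I F Q) (hIc : ContinuousOn I (F '' Q))
    {q : E} (hq : q ∈ Q) {A : E →L[ℝ] E} (hA : A.IsInvertible) (hF : HasFDerivWithinAt F A Q q)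
    {f w : E → G} {w' : E →L[ℝ] G} (hw : HasFDerivWithinAt w w' Q q) (hf : ∀ x ∈ Q, f (F x) = w x) :
    HasFDerivWithinAt f (w' ∘L A.inverse) (F '' Q) (F q) := by
  obtain ⟨A, rfl⟩ := hA
  have hmaps : MapsTo I (F '' Q) Q := by
    rintro _ ⟨x, hx, rfl⟩; rwa [hI hx]
  have hIq : I (F q) = q := hI hq
  have h1 : HasFDerivWithinAt I (A.symm : E →L[ℝ] E) (F '' Q) (F q) := by
    refine HasFDerivWithinAt.of_local_left_inverse (f := F) (t := Q) ?_ (by rwa [hIq])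
      ⟨q, hq, rfl⟩ ?_
    · have := (hIc (F q) ⟨q, hq, rfl⟩).tendsto_nhdsWithin hmaps
      rwa [hIq] at this ⊢
    · filter_upwards [self_mem_nhdsWithin]
      rintro _ ⟨x, hx, rfl⟩
      rw [hI hx]
  have h2 : HasFDerivWithinAt (w ∘ I) (w' ∘L (A.symm : E →L[ℝ] E)) (F '' Q) (F q) :=
    HasFDerivWithinAt.comp (t := Q) (F q) (by rwa [hIq]) h1 hmaps
  rw [ContinuousLinearMap.inverse_equiv]
  refine h2.congr ?_ ?_
  · rintro _ ⟨x, hx, rfl⟩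
    rw [hf x hx, Function.comp_apply, hI hx]
  · rw [hf q hq, Function.comp_apply, hIq]

/-- A function on `F '' Q ∪ B` which vanishes on `B` and whose pullback to `Q` vanishes to order
`m + 1` along the set that is mapped to `B` is of class `C^m`. -/
theorem contDiffOn_image_union {E : Type} [NormedAddCommGroup E] [NormedSpace ℝ E]
    [CompleteSpace E] {Q B : Set E} (hQ : UniqueDiffOn ℝ Q) {F I : E → E} {u : E → ℝ}
    (hI : LeftInvOn I F Q) (hIc : ContinuousOn I (F '' Q)) (hFQ : IsClosed (F '' Q))
    (hB : IsClosed B) (hu0 : ∀ q ∈ Q, F q ∈ B → u q = 0)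
    (hinv : ∀ q ∈ Q, (fderivWithin ℝ F Q q).IsInvertible) (m : ℕ) :
    ContDiffOn ℝ m F Q → ContDiffOn ℝ m u Q →
    ∀ {G : Type} [NormedAddCommGroup G] [NormedSpace ℝ G] {f g : E → G},
      ContDiffOn ℝ m g Q → (∀ q ∈ Q, f (F q) = u q ^ (m + 1) • g q) → (∀ y ∈ B, f y = 0) →
      ContDiffOn ℝ m f (F '' Q ∪ B) := by
  induction m with
  | zero =>
    intro _ hu G _ _ f g hg hfg hfB
    rw [Nat.cast_zero, contDiffOn_zero] at hg hu ⊢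
    refine ContinuousOn.union_of_isClosed ?_ ?_ hFQ hB
    · have hmaps : MapsTo I (F '' Q) Q := by
        rintro _ ⟨x, hx, rfl⟩; rwa [hI hx]
      refine (((hu.pow 1).smul hg).comp hIc hmaps).congr ?_
      rintro _ ⟨x, hx, rfl⟩
      simp [hfg x hx, hI hx]
    · exact continuousOn_const.congr hfB
  | succ m ih =>
    intro hF hu G _ _ f g hg hfg hfB
    have hle : ((m : ℕ) : WithTop ℕ∞) ≤ ((m + 1 : ℕ) : WithTop ℕ∞) := by
      exact_mod_cast Nat.le_succ m
    have hne : ((m + 1 : ℕ) : WithTop ℕ∞) ≠ 0 := by exact_mod_cast Nat.succ_ne_zero m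
    classical
    -- From `D(u^(m+2) g) = u^(m+1) ((m+2) Du ⊗ g + u Dg)`, composed with the inverse of `DF`.
    let h : E → E →L[ℝ] G := fun q =>
      (((m : ℝ) + 2) • (fderivWithin ℝ u Q q).smulRight (g q) + u q • fderivWithin ℝ g Q q) ∘L
        (fderivWithin ℝ F Q q).inverse
    have hd : ∀ {G : Type} [NormedAddCommGroup G] [NormedSpace ℝ G] {g : E → G},
        ContDiffOn ℝ (m + 1 : ℕ) g Q → ContDiffOn ℝ m (fderivWithin ℝ g Q) Q := by
      intro G _ _ g hg
      exact hg.fderivWithin hQ (by norm_cast)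
    have hh : ContDiffOn ℝ m h Q := by
      refine ContDiffOn.clm_comp ?_ ?_
      · exact ((contDiffOn_const (c := (m : ℝ) + 2)).smul ((hd hu).smulRight (hg.of_le hle))).add
          ((hu.of_le hle).smul (hd hg))
      · intro q hq
        exact (hinv q hq).contDiffAt_map_inverse.comp_contDiffWithinAt q (hd hF q hq)
    let f' : E → E →L[ℝ] G := fun y =>
      if y ∈ F '' Q then u (I y) ^ (m + 1) • h (I y) else 0
    have hf'F : ∀ q ∈ Q, f' (F q) = u q ^ (m + 1) • h q := fun q hq => by
      simp only [f', if_pos (mem_image_of_mem F hq), hI hq]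
    have hf'B : ∀ y ∈ B, f' y = 0 := by
      intro y hy
      -- On the overlap `u = 0`, and the exponent `m + 1` is positive, so both prescriptions of the
      -- derivative agree.
      by_cases hyF : y ∈ F '' Q
      · obtain ⟨q, hq, rfl⟩ := hyF
        rw [hf'F q hq, hu0 q hq hy]; simp
      · simp only [f', if_neg hyF]
    -- The induction quantifies over the target `G`, since here it is applied with `E →L[ℝ] G`.
    have hf' : ContDiffOn ℝ m f' (F '' Q ∪ B) :=
      ih (hF.of_le hle) (hu.of_le hle) hh hf'F hf'B
    have hderF : ∀ y ∈ F '' Q, HasFDerivWithinAt f (f' y) (F '' Q) y := by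
      rintro _ ⟨q, hq, rfl⟩
      have hdF := ((hF.differentiableOn hne) q hq).hasFDerivWithinAt
      have hdu := ((hu.differentiableOn hne) q hq).hasFDerivWithinAt
      have hdg := ((hg.differentiableOn hne) q hq).hasFDerivWithinAt
      have hw := (hdu.pow (m + 2)).smul hdg
      have := hasFDerivWithinAt_comp_leftInvOn hI hIc hq (hinv q hq) hdF hw hfg
      convert this using 1
      rw [hf'F q hq]
      ext z
      simp [h, smul_smul]
      module
    have hder : ∀ y ∈ F '' Q ∪ B, HasFDerivWithinAt f (f' y) (F '' Q ∪ B) y := by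
      intro y hy
      -- Both sets are closed, so differentiability within a set that does not contain `y` is
      -- vacuous.
      refine HasFDerivWithinAt.union ?_ ?_
      · by_cases hyF : y ∈ F '' Q
        · exact hderF y hyF
        · exact HasFDerivWithinAt.of_notMem_closure (by rwa [hFQ.closure_eq])
      · by_cases hyB : y ∈ B
        · rw [hf'B y hyB]
          exact (hasFDerivWithinAt_const (0 : G) y B).congr hfB (hfB y hyB)
        · exact HasFDerivWithinAt.of_notMem_closure (by rwa [hB.closure_eq])
    intro y hy
    -- This criterion accepts any derivative field `f'`, so unique differentiability of the union is
    -- not required.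
    rw [Nat.cast_succ, contDiffWithinAt_succ_iff_hasFDerivWithinAt (by norm_cast; simp)]
    refine ⟨F '' Q ∪ B, by rw [insert_eq_of_mem hy]; exact self_mem_nhdsWithin,
      by simp, f', hder, hf' y hy⟩

end Iso

/-! ### Smoothness, divisibility and linear independence of B-splines. -/

namespace Iso

open Set Polynomial Filter Topology

theorem contDiff_eval (P : ℝ[X]) (m : ℕ) : ContDiff ℝ m fun x => P.eval x := by
  simpa using P.contDiff_aeval (R := ℝ) (𝕜 := ℝ) m

theorem hasDerivAt_min_zero_pow (m : ℕ) (x : ℝ) :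
    HasDerivAt (fun y : ℝ => min y 0 ^ (m + 2)) (((m : ℝ) + 2) * min x 0 ^ (m + 1)) x := by
  have hc : ∀ l : ℕ, Continuous fun y : ℝ => min y 0 ^ l := fun l => by fun_prop
  have hne : ∀ y : ℝ, y ≠ 0 →
      HasDerivAt (fun y : ℝ => min y 0 ^ (m + 2)) (((m : ℝ) + 2) * min y 0 ^ (m + 1)) y := by
    intro y hy
    rcases hy.lt_or_gt with h | h
    · have h1 : HasDerivAt (fun y : ℝ => y ^ (m + 2)) (((m : ℝ) + 2) * min y 0 ^ (m + 1)) y := by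
        rw [min_eq_left h.le]
        simpa using hasDerivAt_pow (m + 2) y
      refine h1.congr_of_eventuallyEq ?_
      filter_upwards [Iio_mem_nhds h] with z hz
      rw [min_eq_left (le_of_lt hz)]
    · have h1 : HasDerivAt (fun _ : ℝ => (0 : ℝ)) (((m : ℝ) + 2) * min y 0 ^ (m + 1)) y := by
        rw [min_eq_right h.le]
        simpa using hasDerivAt_const y (0 : ℝ)
      refine h1.congr_of_eventuallyEq ?_
      filter_upwards [Ioi_mem_nhds h] with z hz
      rw [min_eq_right (le_of_lt hz)]
      simp
  rcases eq_or_ne x 0 with rfl | hx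
  · exact hasDerivAt_of_hasDerivAt_of_ne (g := fun y => ((m : ℝ) + 2) * min y 0 ^ (m + 1)) hne
      (hc _).continuousAt (continuous_const.mul (hc _)).continuousAt
  · exact hne x hx

/-- Truncated powers describe the jump between two adjacent polynomial pieces. -/
theorem contDiff_min_zero_pow (m : ℕ) : ContDiff ℝ m fun y : ℝ => min y 0 ^ (m + 1) := by
  induction m with
  | zero => exact contDiff_zero.2 (by fun_prop)
  | succ m ih =>
    rw [Nat.cast_succ, contDiff_succ_iff_deriv]
    refine ⟨fun x => (hasDerivAt_min_zero_pow m x).differentiableAt, by simp, ?_⟩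
    rw [show deriv (fun y : ℝ => min y 0 ^ (m + 1 + 1)) = fun y => ((m : ℝ) + 2) * min y 0 ^ (m + 1)
      from funext fun x => (hasDerivAt_min_zero_pow m x).deriv]
    exact contDiff_const.mul ih

/-- `t` is an open knot vector on `[0, 1]` for `n` B-splines of degree `p`, with inner knots of
multiplicity at most `s`. -/
structure IsOpenKnots (t : ℕ → ℝ) (p s n : ℕ) : Prop where
  monotone : Monotone t
  le_one : ∀ i, t i ≤ 1
  eq_zero : ∀ i ≤ p, t i = 0
  pos : ∀ i, p < i → 0 < t i
  lt_one : ∀ i < n, t i < 1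
  eq_one : ∀ i, n ≤ i → t i = 1
  lt_add : ∀ i, 0 < t i → t i < 1 → t i < t (i + s)

/-- Together with `exists_le_and_lt_succ` this brackets `x` from both sides: at a knot `x`, the
indices `a + 1, …, b` are exactly those with value `x`. -/
theorem exists_lt_and_le_succ {t : ℕ → ℝ} {x : ℝ} (h0 : t 0 < x) {n : ℕ} (hn : x ≤ t n) :
    ∃ a < n, t a < x ∧ x ≤ t (a + 1) := by
  classical
  have hex : ∃ l, x ≤ t l := ⟨n, hn⟩
  have hpos : Nat.find hex ≠ 0 := fun h => by
    have := Nat.find_spec hex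
    rw [h] at this; linarith
  have hle : Nat.find hex ≤ n := Nat.find_min' hex hn
  refine ⟨Nat.find hex - 1, by omega, not_le.1 (Nat.find_min hex (by omega)), ?_⟩
  rw [Nat.sub_add_cancel (by omega)]
  exact Nat.find_spec hex

theorem exists_le_and_lt_succ {t : ℕ → ℝ} {x : ℝ} (h0 : t 0 ≤ x) {n : ℕ} (hn : x < t n) :
    ∃ b < n, t b ≤ x ∧ x < t (b + 1) := by
  classical
  have hex : ∃ l, x < t l := ⟨n, hn⟩
  have hpos : Nat.find hex ≠ 0 := fun h => by
    have := Nat.find_spec hex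
    rw [h] at this; linarith
  have hle : Nat.find hex ≤ n := Nat.find_min' hex hn
  refine ⟨Nat.find hex - 1, by omega, not_lt.1 (Nat.find_min hex (by omega)), ?_⟩
  rw [Nat.sub_add_cancel (by omega)]
  exact Nat.find_spec hex

namespace IsOpenKnots

variable {t : ℕ → ℝ} {p s n : ℕ}

theorem bspline_eq_of_mem (ht : IsOpenKnots t p s n) {j : ℕ} {x : ℝ} (h1 : t j ≤ x)
    (h2 : x < t (j + 1)) (d i : ℕ) : bspline t d i x = (spanPoly t j d i).eval x := by
  refine bspline_eq_eval_spanPoly t j x (fun i => ⟨?_, ?_⟩) d i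
  · rintro (⟨h3, h4⟩ | ⟨rfl, -, -⟩)
    · have := ht.monotone.reflect_lt (h3.trans_lt h2)
      have := ht.monotone.reflect_lt (h1.trans_lt h4)
      omega
    · linarith [ht.le_one (j + 1)]
  · rintro rfl
    exact Or.inl ⟨h1, h2⟩

theorem bspline_eq_at_one (ht : IsOpenKnots t p s n) {j : ℕ} (h1 : t j < 1)
    (h2 : t (j + 1) = 1) (d i : ℕ) : bspline t d i 1 = (spanPoly t j d i).eval 1 := by
  refine bspline_eq_eval_spanPoly t j 1 (fun i => ⟨?_, ?_⟩) d i
  · rintro (⟨h3, h4⟩ | ⟨-, h3, h4⟩)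
    · linarith [ht.le_one (i + 1)]
    · have := ht.monotone.reflect_lt (h3.trans_eq h2.symm)
      have := ht.monotone.reflect_lt (h1.trans_eq h4.symm)
      omega
  · rintro rfl
    exact Or.inr ⟨rfl, h1, h2⟩

theorem bspline_eventuallyEq_zero (ht : IsOpenKnots t p s n) (d i : ℕ) :
    bspline t d i =ᶠ[𝓝[Icc 0 1] 0] fun x => (spanPoly t p d i).eval x := by
  filter_upwards [self_mem_nhdsWithin,
    mem_nhdsWithin_of_mem_nhds (Iio_mem_nhds (ht.pos (p + 1) (Nat.lt_succ_self p)))] with x hx hx'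
  exact ht.bspline_eq_of_mem (by rw [ht.eq_zero p le_rfl]; exact hx.1) hx' d i

/-- B-splines of degree `d` are of class `C^m` if the inner knots have multiplicity at most
`d - m`. -/
theorem contDiffOn_bspline (ht : IsOpenKnots t p s n) {m d : ℕ} (hd : m + s ≤ d) (i : ℕ) :
    ContDiffOn ℝ m (bspline t d i) (Icc 0 1) := by
  have hpoly : ∀ (P : ℝ[X]) (x : ℝ), ContDiffWithinAt ℝ m (fun y => P.eval y) (Icc 0 1) x :=
    fun P x => (contDiff_eval P m).contDiffWithinAt
  intro x hx
  rcases hx.1.eq_or_lt with rfl | hx0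
  · exact (hpoly (spanPoly t p d i) 0).congr_of_eventuallyEq_of_mem
      (ht.bspline_eventuallyEq_zero d i) hx
  obtain ⟨a, -, ha, hxa⟩ := exists_lt_and_le_succ (t := t) (x := x) (n := n)
    (by rwa [ht.eq_zero 0 (Nat.zero_le _)]) (by rw [ht.eq_one n le_rfl]; exact hx.2)
  rcases hxa.lt_or_eq with hxa | hxa
  · refine (hpoly (spanPoly t a d i) x).congr_of_eventuallyEq_of_mem ?_ hx
    filter_upwards [mem_nhdsWithin_of_mem_nhds (Ioo_mem_nhds ha hxa)] with y hy
    exact ht.bspline_eq_of_mem hy.1.le hy.2 d i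
  rcases hx.2.eq_or_lt with rfl | hx1
  · refine (hpoly (spanPoly t a d i) 1).congr_of_eventuallyEq_of_mem ?_ hx
    filter_upwards [self_mem_nhdsWithin, mem_nhdsWithin_of_mem_nhds (Ioi_mem_nhds ha)] with y hy hya
    rcases hy.2.eq_or_lt with rfl | hy1
    · exact ht.bspline_eq_at_one ha hxa.symm d i
    · exact ht.bspline_eq_of_mem (le_of_lt hya) (by rwa [← hxa]) d i
  obtain ⟨b, -, hb, hxb⟩ := exists_le_and_lt_succ (t := t) (x := x) (n := n)
    (by rw [ht.eq_zero 0 (Nat.zero_le _)]; exact hx.1) (by rwa [ht.eq_one n le_rfl])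
  obtain ⟨l, rfl⟩ : ∃ l, b = a + l := by
    have := ht.monotone.reflect_lt (ha.trans hxb)
    exact ⟨b - a, by omega⟩
  have hal : a + 1 < a + l + 1 := ht.monotone.reflect_lt (by rwa [← hxa])
  have hl : ∀ e, 1 ≤ e → e ≤ l → t (a + e) = x := fun e h1 h2 =>
    le_antisymm ((ht.monotone (by omega)).trans hb) (hxa.trans_le (ht.monotone (by omega)))
  -- Here `l` is the multiplicity of the knot `x`.
  have hls : l ≤ s := by
    by_contra hlt
    have h := ht.lt_add (a + 1) (by rwa [← hxa]) (by rwa [← hxa])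
    rw [hl 1 le_rfl (by omega), add_assoc, hl (1 + s) (by omega) (by omega)] at h
    exact lt_irrefl _ h
  obtain ⟨R, hR⟩ := X_sub_C_pow_dvd_spanPoly_sub ht.monotone ha hxb hl (show m + l ≤ d by omega) i
  -- Near `x` the B-spline is its right piece plus a left-supported truncated power times the
  -- quotient `R`.
  have hsm : ContDiffWithinAt ℝ m
      (fun y => (spanPoly t (a + l) d i).eval y + min (y - x) 0 ^ (m + 1) * R.eval y)
      (Icc 0 1) x := by
    refine (hpoly _ x).add (ContDiffWithinAt.mul ?_ (hpoly R x))
    exact ((contDiff_min_zero_pow m).comp (contDiff_id.sub contDiff_const)).contDiffWithinAt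
  refine hsm.congr_of_eventuallyEq_of_mem ?_ hx
  filter_upwards [mem_nhdsWithin_of_mem_nhds (Ioo_mem_nhds ha hxb)] with y hy
  rcases lt_or_ge y x with h | h
  · rw [ht.bspline_eq_of_mem hy.1.le (by rwa [← hxa]) d i, min_eq_left (by linarith)]
    have := congrArg (eval y) hR
    simp only [eval_sub, eval_mul, eval_pow, eval_X, eval_C] at this
    linarith
  · rw [ht.bspline_eq_of_mem (hb.trans h) hy.2 d i, min_eq_right (by linarith)]
    simp

/-- Division by `x ^ l` costs no smoothness: near `0` the B-spline is a polynomial divisible by `X ^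
i` (or zero, if `i > p`), and elsewhere `x ^ l` is invertible. -/
theorem exists_bspline_eq_pow_mul (ht : IsOpenKnots t p s n) {m : ℕ} (hm : m + s ≤ p) {l i : ℕ}
    (hi : l ≤ i) : ∃ R : ℝ → ℝ, ContDiffOn ℝ m R (Icc 0 1) ∧
      ∀ x ∈ Icc (0 : ℝ) 1, bspline t p i x = x ^ l * R x := by
  have hp0 : t p = 0 := ht.eq_zero p le_rfl
  have hp1 : t p < t (p + 1) := by rw [hp0]; exact ht.pos _ (Nat.lt_succ_self p)
  obtain ⟨T, hT⟩ : ∃ T : ℝ[X], spanPoly t p p i = X ^ l * T := by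
    rcases le_or_gt i p with h | h
    · obtain ⟨S, hS, -⟩ := exists_spanPoly_eq_pow_mul ht.monotone hp1 p i h (by omega)
        (by rw [ht.eq_zero i h, hp0])
      refine ⟨X ^ (i - l) * S, ?_⟩
      rw [hS, hp0, C_0, sub_zero, ← mul_assoc, ← pow_add, show i + p - p = l + (i - l) by omega]
    · exact ⟨0, by rw [spanPoly_eq_zero_of_lt t p h, mul_zero]⟩
  have hnear : ∀ x, 0 ≤ x → x < t (p + 1) → bspline t p i x = x ^ l * T.eval x := by
    intro x h0 h1
    rw [ht.bspline_eq_of_mem (by rwa [hp0]) h1, hT]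
    simp
  classical
  refine ⟨fun x => if x < t (p + 1) then T.eval x else bspline t p i x / x ^ l, ?_, ?_⟩
  · intro x hx
    rcases hx.1.eq_or_lt with rfl | hx0
    · refine (contDiff_eval T m).contDiffWithinAt.congr_of_eventuallyEq_of_mem ?_ hx
      filter_upwards [mem_nhdsWithin_of_mem_nhds (Iio_mem_nhds (hp0 ▸ hp1))] with y hy
      exact if_pos hy
    · have : ContDiffWithinAt ℝ m (fun y => bspline t p i y / y ^ l) (Icc 0 1) x :=
        (ht.contDiffOn_bspline hm i x hx).div (contDiff_id.pow l).contDiffWithinAt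
          (pow_ne_zero l hx0.ne')
      refine this.congr_of_eventuallyEq_of_mem ?_ hx
      filter_upwards [mem_nhdsWithin_of_mem_nhds (Ioi_mem_nhds hx0)] with y hy
      split_ifs with h
      · rw [hnear y (le_of_lt hy) h, mul_div_cancel_left₀ _ (pow_ne_zero l (ne_of_gt hy))]
      · rfl
  · intro x hx
    dsimp only
    split_ifs with h
    · exact hnear x hx.1 h
    · have : (0 : ℝ) < x := (hp0 ▸ hp1).trans_le (not_lt.1 h)
      rw [mul_div_cancel₀ _ (pow_ne_zero l this.ne')]

/-- On the nonempty span starting at the knot `t l`, the `l`-th piece has the lowest order of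
vanishing among those with a coefficient not yet known to be zero. Hence its coefficient is zero, by
strong induction on `l`. -/
theorem linearIndependent_bspline (ht : IsOpenKnots t p s n) (hs : s ≤ p) (c : Fin n → ℝ)
    (hc : ∀ x ∈ Icc (0 : ℝ) 1, ∑ i, c i * bspline t p i x = 0) : c = 0 := by
  suffices h : ∀ (l : ℕ) (hl : l < n), c ⟨l, hl⟩ = 0 by
    funext i; exact h i i.2
  intro l
  induction l using Nat.strong_induction_on with
  | _ l ih =>
    intro hl
    -- `b` is the last index with `t b = t l`.
    obtain ⟨b, -, hb, hlb⟩ := exists_le_and_lt_succ (t := t) (x := t l) (n := n)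
      (ht.monotone (Nat.zero_le _)) (by rw [ht.eq_one n le_rfl]; exact ht.lt_one l hl)
    have hl_le : l ≤ b := Nat.lt_succ_iff.1 (ht.monotone.reflect_lt hlb)
    have htb : t b = t l := le_antisymm hb (ht.monotone hl_le)
    have hbl : b ≤ l + p := by
      by_contra hlt
      rcases le_or_gt l p with h | h
      · have := ht.pos b (by omega)
        rw [htb, ht.eq_zero l h] at this
        exact lt_irrefl _ this
      · have h1 := ht.lt_add l (ht.pos l h) (ht.lt_one l hl)
        have h2 : t (l + s) ≤ t b := ht.monotone (by omega)
        linarith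
    have hbb : t b < t (b + 1) := by rwa [htb]
    have hpoly : ∑ i : Fin n, C (c i) * spanPoly t b p i = 0 := by
      refine Polynomial.eq_of_infinite_eval_eq _ _ ((Ico_infinite hbb).mono fun x hx => ?_)
      have h0 : 0 ≤ t b := (ht.eq_zero 0 (Nat.zero_le _)).ge.trans (ht.monotone (Nat.zero_le _))
      have := hc x ⟨h0.trans hx.1, hx.2.le.trans (ht.le_one _)⟩
      simp only [mem_ofPred_eq, eval_finsetSum, eval_mul, eval_C, eval_zero]
      rw [← this]
      exact Finset.sum_congr rfl fun i _ => by rw [ht.bspline_eq_of_mem hx.1 hx.2]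
    have hdvd : ∀ i ∈ Finset.univ.erase (⟨l, hl⟩ : Fin n),
        (X - C (t b)) ^ (l + p - b + 1) ∣ C (c i) * spanPoly t b p i := by
      intro i hi
      have hne : (i : ℕ) ≠ l := fun h => (Finset.mem_erase.1 hi).1 (Fin.ext h)
      rcases lt_or_gt_of_ne hne with h | h
      · rw [show c i = 0 from ih i h i.2]; simp
      rcases le_or_gt (i : ℕ) b with h' | h'
      · obtain ⟨S, hS, -⟩ := exists_spanPoly_eq_pow_mul ht.monotone hbb p i h' (by omega)
          (le_antisymm (ht.monotone h') (htb ▸ ht.monotone h.le))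
        rw [hS]
        exact Dvd.dvd.mul_left ((pow_dvd_pow _ (by omega)).trans (dvd_mul_right _ _)) _
      · rw [spanPoly_eq_zero_of_lt t p h']; simp
    rw [← Finset.add_sum_erase _ _ (Finset.mem_univ (⟨l, hl⟩ : Fin n))] at hpoly
    -- All other terms are divisible by one power more than the exact order `l + p - b` of the
    -- `l`-th piece.
    have h1 : (X - C (t b)) ^ (l + p - b + 1) ∣ C (c ⟨l, hl⟩) * spanPoly t b p l := by
      rw [eq_neg_of_add_eq_zero_left hpoly]
      exact (Finset.dvd_sum hdvd).neg_right
    obtain ⟨S, hS, hS0⟩ := exists_spanPoly_eq_pow_mul ht.monotone hbb p l hl_le hbl htb.symm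
    rw [hS, mul_left_comm, pow_succ] at h1
    have h2 := dvd_iff_isRoot.1
      ((mul_dvd_mul_iff_left (pow_ne_zero _ (X_sub_C_ne_zero (t b)))).1 h1)
    rw [IsRoot, eval_mul, eval_C] at h2
    exact (mul_eq_zero.1 h2).resolve_right hS0.ne'

end IsOpenKnots

theorem isOpenKnots_knot {p r k : ℕ} (hr : r < p) {τ : Fin k → ℝ} (hτ : StrictMono τ)
    (hτ01 : ∀ m, 0 < τ m ∧ τ m < 1) :
    IsOpenKnots (knot p r τ) p (p - r) (p + 1 + k * (p - r)) := by
  have hs : 0 < p - r := by omega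
  have hzero : ∀ i ≤ p, knot p r τ i = 0 := fun i hi => by rw [knot, if_pos hi]
  have hin : ∀ i, p < i → ∀ h : (i - (p + 1)) / (p - r) < k, knot p r τ i = τ ⟨_, h⟩ :=
    fun i hi h => by rw [knot, if_neg (by omega), dif_pos h]
  have hone : ∀ i, p < i → ¬ (i - (p + 1)) / (p - r) < k → knot p r τ i = 1 :=
    fun i hi h => by rw [knot, if_neg (by omega), dif_neg h]
  have hle : ∀ i, knot p r τ i ≤ 1 := by
    intro i
    rw [knot]; split_ifs
    · exact zero_le_one
    · exact (hτ01 _).2.le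
    · exact le_rfl
  have hlt : ∀ i, p < i → ((i - (p + 1)) / (p - r) < k ↔ i < p + 1 + k * (p - r)) := by
    intro i hi
    rw [Nat.div_lt_iff_lt_mul hs]; omega
  have hpos : ∀ i, p < i → 0 < knot p r τ i := by
    intro i hi
    by_cases h : (i - (p + 1)) / (p - r) < k
    · rw [hin i hi h]; exact (hτ01 _).1
    · rw [hone i hi h]; exact zero_lt_one
  refine ⟨?_, hle, hzero, hpos, ?_, ?_, ?_⟩
  · intro i j hij
    rcases le_or_gt i p with hi | hi
    · rw [hzero i hi]
      rcases le_or_gt j p with hj | hj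
      · rw [hzero j hj]
      · exact (hpos j hj).le
    · by_cases h : (j - (p + 1)) / (p - r) < k
      · have hd : (i - (p + 1)) / (p - r) ≤ (j - (p + 1)) / (p - r) :=
          Nat.div_le_div_right (by omega)
        rw [hin i hi (hd.trans_lt h), hin j (by omega) h]
        exact hτ.monotone hd
      · rw [hone j (by omega) h]; exact hle i
  · intro i hi
    rcases le_or_gt i p with h | h
    · rw [hzero i h]; exact zero_lt_one
    · rw [hin i h ((hlt i h).2 hi)]; exact (hτ01 _).2
  · intro i hi
    exact hone i (by omega) fun h => absurd ((hlt i (by omega)).1 h) (by omega)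
  · intro i h0 h1
    have hi : p < i := by
      by_contra h; rw [hzero i (by omega)] at h0; exact lt_irrefl _ h0
    have h : (i - (p + 1)) / (p - r) < k := by
      by_contra h; rw [hone i hi h] at h1; exact lt_irrefl _ h1
    -- Shifting an index by the multiplicity moves to the next distinct knot, so no inner knot
    -- repeats more than `p - r` times.
    have hd : (i + (p - r) - (p + 1)) / (p - r) = (i - (p + 1)) / (p - r) + 1 := by
      rw [show i + (p - r) - (p + 1) = i - (p + 1) + (p - r) by omega, Nat.add_div_right _ hs]
    by_cases h' : (i + (p - r) - (p + 1)) / (p - r) < k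
    · rw [hin i hi h, hin _ (by omega) h']
      exact hτ (Fin.lt_def.2 (by dsimp only; omega))
    · rw [hone _ (by omega) h']; exact h1

end Iso

/-! ### Geometry of the two patches and smoothness of the basis functions. -/

namespace Iso

open Set Filter Topology

/-- The extension of a function on `[0, 1]²` to the plane, constant along the projections to
`[0, 1]` in both coordinates. -/
noncomputable def planeExtend {E : Type*} (g : unitInterval × unitInterval → E) (z : ℝ × ℝ) : E :=
  g (projIcc 0 1 zero_le_one z.1, projIcc 0 1 zero_le_one z.2)

/-- The unit square `[0, 1]²` in the plane. -/
def unitSquare : Set (ℝ × ℝ) := Icc 0 1 ×ˢ Icc 0 1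

theorem planeExtend_coe {E : Type*} (g : unitInterval × unitInterval → E)
    (q : unitInterval × unitInterval) : planeExtend g ((q.1 : ℝ), (q.2 : ℝ)) = g q := by
  simp only [planeExtend, projIcc_val]

theorem coe_mem_unitSquare (q : unitInterval × unitInterval) :
    ((q.1 : ℝ), (q.2 : ℝ)) ∈ unitSquare := ⟨q.1.2, q.2.2⟩

theorem exists_eq_coe_of_mem_unitSquare {z : ℝ × ℝ} (hz : z ∈ unitSquare) :
    ∃ q : unitInterval × unitInterval, z = ((q.1 : ℝ), (q.2 : ℝ)) :=
  ⟨(⟨z.1, hz.1⟩, ⟨z.2, hz.2⟩), rfl⟩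

theorem planeExtend_image_unitSquare {E : Type*} (g : unitInterval × unitInterval → E) :
    planeExtend g '' unitSquare = range g := by
  ext y
  constructor
  · rintro ⟨z, hz, rfl⟩
    obtain ⟨q, rfl⟩ := exists_eq_coe_of_mem_unitSquare hz
    exact ⟨q, (planeExtend_coe g q).symm⟩
  · rintro ⟨q, rfl⟩
    exact ⟨_, coe_mem_unitSquare q, planeExtend_coe g q⟩

theorem isCompact_unitSquare : IsCompact unitSquare := isCompact_Icc.prod isCompact_Icc

theorem uniqueDiffOn_unitSquare : UniqueDiffOn ℝ unitSquare :=
  (uniqueDiffOn_Icc zero_lt_one).prod (uniqueDiffOn_Icc zero_lt_one)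

theorem contDiffOn_of_mem_splineSpace {p r k m : ℕ} {τ : Fin k → ℝ} {s n : ℕ}
    (ht : IsOpenKnots (knot p r τ) p s n) (hm : m + s ≤ p) {f : unitInterval → ℝ}
    (hf : f ∈ splineSpace p r τ) :
    ContDiffOn ℝ m (fun x => f (projIcc 0 1 zero_le_one x)) (Icc 0 1) := by
  induction hf using Submodule.span_induction with
  | mem f hf =>
    obtain ⟨i, rfl⟩ := hf
    refine (ht.contDiffOn_bspline hm i).congr fun x hx => ?_
    rw [N, projIcc_of_mem _ hx]
  | zero => exact contDiffOn_const
  | add f g _ _ hf hg => exact hf.add hg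
  | smul c f _ hf => exact contDiffOn_const.mul hf

theorem contDiffOn_of_mem_splineSpace₂ {p r k m : ℕ} {τ : Fin k → ℝ} {s n : ℕ}
    (ht : IsOpenKnots (knot p r τ) p s n) (hm : m + s ≤ p)
    {f : unitInterval × unitInterval → ℝ} (hf : f ∈ splineSpace₂ p r τ) :
    ContDiffOn ℝ m (planeExtend f) unitSquare := by
  induction hf using Submodule.span_induction with
  | mem f hf =>
    obtain ⟨a, ha, b, hb, rfl⟩ := hf
    exact ((contDiffOn_of_mem_splineSpace ht hm ha).comp contDiffOn_fst fun z hz => hz.1).mul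
      ((contDiffOn_of_mem_splineSpace ht hm hb).comp contDiffOn_snd fun z hz => hz.2)
  | zero => exact contDiffOn_const
  | add f g _ _ hf hg => exact hf.add hg
  | smul c f _ hf => exact contDiffOn_const.mul hf

theorem NN_mem_splineSpace₂ (p r : ℕ) {k : ℕ} (τ : Fin k → ℝ)
    (i j : Fin (p + 1 + k * (p - r))) : NN p r τ i j ∈ splineSpace₂ p r τ :=
  Submodule.subset_span ⟨_, Submodule.subset_span ⟨i, rfl⟩, _, Submodule.subset_span ⟨j, rfl⟩, rfl⟩

section PartialDerivatives

variable {E : Type*} [NormedAddCommGroup E] [NormedSpace ℝ E] {g : unitInterval × unitInterval → E}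
  {q : unitInterval × unitInterval} {A : ℝ × ℝ →L[ℝ] E}

theorem Du_eq_of_hasFDerivWithinAt
    (h : HasFDerivWithinAt (planeExtend g) A unitSquare ((q.1 : ℝ), (q.2 : ℝ))) :
    Du g q = A (1, 0) := by
  have h1 : HasDerivWithinAt (fun u : ℝ => (u, (q.2 : ℝ))) (1, 0) (Icc 0 1) q.1 :=
    (hasDerivWithinAt_id _ _).prodMk (hasDerivWithinAt_const _ _ _)
  have hmaps : MapsTo (fun u : ℝ => (u, (q.2 : ℝ))) (Icc 0 1) unitSquare :=
    fun u hu => ⟨hu, q.2.2⟩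
  have h2 := HasFDerivWithinAt.comp_hasDerivWithinAt (q.1 : ℝ) h h1 hmaps
  refine HasDerivWithinAt.derivWithin (h2.congr_of_mem ?_ q.1.2)
    (uniqueDiffOn_Icc zero_lt_one _ q.1.2)
  intro u _
  simp [planeExtend, IccExtend, projIcc_val]

theorem Dv_eq_of_hasFDerivWithinAt
    (h : HasFDerivWithinAt (planeExtend g) A unitSquare ((q.1 : ℝ), (q.2 : ℝ))) :
    Dv g q = A (0, 1) := by
  have h1 : HasDerivWithinAt (fun v : ℝ => ((q.1 : ℝ), v)) (0, 1) (Icc 0 1) q.2 :=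
    (hasDerivWithinAt_const _ _ _).prodMk (hasDerivWithinAt_id _ _)
  have hmaps : MapsTo (fun v : ℝ => ((q.1 : ℝ), v)) (Icc 0 1) unitSquare :=
    fun v hv => ⟨q.1.2, hv⟩
  have h2 := HasFDerivWithinAt.comp_hasDerivWithinAt (q.2 : ℝ) h h1 hmaps
  refine HasDerivWithinAt.derivWithin (h2.congr_of_mem ?_ q.2.2)
    (uniqueDiffOn_Icc zero_lt_one _ q.2.2)
  intro u _
  simp [planeExtend, IccExtend, projIcc_val]

end PartialDerivatives

/-- Cramer's rule gives injectivity, which suffices in finite dimension. -/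
theorem isInvertible_of_det_ne_zero (A : ℝ × ℝ →L[ℝ] ℝ × ℝ)
    (h : (A (1, 0)).1 * (A (0, 1)).2 - (A (1, 0)).2 * (A (0, 1)).1 ≠ 0) : A.IsInvertible := by
  have hinj : Function.Injective (A : ℝ × ℝ →ₗ[ℝ] ℝ × ℝ) := by
    rw [← LinearMap.ker_eq_bot, LinearMap.ker_eq_bot']
    rintro ⟨x, y⟩ hxy
    have hdec : A (x, y) = x • A (1, 0) + y • A (0, 1) := by
      rw [← map_smul, ← map_smul, ← map_add]; simp
    have hxy' : x • A (1, 0) + y • A (0, 1) = 0 := by rw [← hdec]; exact hxy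
    have e1 : x * (A (1, 0)).1 + y * (A (0, 1)).1 = 0 := by simpa using congrArg Prod.fst hxy'
    have e2 : x * (A (1, 0)).2 + y * (A (0, 1)).2 = 0 := by simpa using congrArg Prod.snd hxy'
    have hx : x = 0 := by
      refine (mul_eq_zero.1 ?_).resolve_right h
      linear_combination (A (0, 1)).2 * e1 - (A (0, 1)).1 * e2
    have hy : y = 0 := by
      refine (mul_eq_zero.1 ?_).resolve_right h
      linear_combination (A (1, 0)).1 * e2 - (A (1, 0)).2 * e1
    rw [hx, hy]; rfl
  refine ⟨(LinearEquiv.ofInjectiveEndo _ hinj).toContinuousLinearEquiv, ?_⟩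
  ext <;> rfl

theorem IsTwoPatch.contDiffOn_planeExtend {p r k m : ℕ} {τ : Fin k → ℝ}
    {F : Side → unitInterval × unitInterval → ℝ × ℝ} (hF : IsTwoPatch p r τ F) {s n : ℕ}
    (ht : IsOpenKnots (knot p r τ) p s n) (hm : m + s ≤ p) (S : Side) :
    ContDiffOn ℝ m (planeExtend (F S)) unitSquare :=
  (contDiffOn_of_mem_splineSpace₂ ht hm (hF.spline_fst S)).prodMk
    (contDiffOn_of_mem_splineSpace₂ ht hm (hF.spline_snd S))

/-- A common point is the image of some `(0, v)` under either mapping, by the interface and edge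
conditions; injectivity identifies the parameters. -/
theorem IsTwoPatch.fst_eq_zero {p r k : ℕ} {τ : Fin k → ℝ}
    {F : Side → unitInterval × unitInterval → ℝ × ℝ} (hF : IsTwoPatch p r τ F) {S S' : Side}
    (hS : S' ≠ S) {q : unitInterval × unitInterval} (hq : F S q ∈ range (F S')) : q.1 = 0 := by
  have key : ∃ v, F Side.L (0, v) = F S q := by
    have : F S q ∈ range (F Side.L) ∩ range (F Side.R) := by
      cases S <;> cases S'
      · exact absurd rfl hS
      · exact ⟨⟨q, rfl⟩, hq⟩
      · exact ⟨hq, ⟨q, rfl⟩⟩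
      · exact absurd rfl hS
    rwa [hF.interface] at this
  obtain ⟨v, hv⟩ := key
  have : F S (0, v) = F S q := by
    cases S
    · exact hv
    · rw [← hF.edge]; exact hv
  rw [← hF.injective S this]

theorem domain_eq_union (F : Side → unitInterval × unitInterval → ℝ × ℝ) {S S' : Side}
    (hS : S' ≠ S) : domain F = range (F S) ∪ range (F S') := by
  cases S <;> cases S'
  · exact absurd rfl hS
  · rfl
  · exact union_comm _ _
  · exact absurd rfl hS

/-- The function with pullback `N_{i,j}` on one patch and `0` on the other is of class `C^m` if
`m < i` and the knot multiplicities are small enough. -/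
theorem IsTwoPatch.exists_contDiffOn {p r k m : ℕ} (hr : r < p) (hm : 1 ≤ m) (hmr : m ≤ r)
    {τ : Fin k → ℝ} (hτ : StrictMono τ) (hτ01 : ∀ m, 0 < τ m ∧ τ m < 1)
    {F : Side → unitInterval × unitInterval → ℝ × ℝ} (hF : IsTwoPatch p r τ F) {S S' : Side}
    (hS : S' ≠ S) (i j : Fin (p + 1 + k * (p - r))) (hi : m + 1 ≤ (i : ℕ)) :
    ∃ f : ℝ × ℝ → ℝ, ContDiffOn ℝ m f (domain F) ∧ (∀ q, f (F S q) = NN p r τ i j q) ∧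
      ∀ q, f (F S' q) = 0 := by
  classical
  have ht := isOpenKnots_knot hr hτ hτ01
  have hms : m + (p - r) ≤ p := by omega
  obtain ⟨R, hR, hRi⟩ := ht.exists_bspline_eq_pow_mul hms hi
  let f : ℝ × ℝ → ℝ := fun y => if h : y ∈ range (F S) then NN p r τ i j h.choose else 0
  have hfS : ∀ q, f (F S q) = NN p r τ i j q := fun q => by
    have h : F S q ∈ range (F S) := ⟨q, rfl⟩
    simp only [f, dif_pos h]
    rw [hF.injective S h.choose_spec]
  have hfS' : ∀ q, f (F S' q) = 0 := by
    intro q'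
    by_cases h : F S' q' ∈ range (F S)
    · obtain ⟨q, hq⟩ := h
      have h0 : q.1 = 0 := hF.fst_eq_zero hS ⟨q', hq.symm⟩
      rw [← hq, hfS, NN, h0, N, hRi _ (0 : unitInterval).2]
      simp
    · simp only [f, dif_neg h]
  refine ⟨f, ?_, hfS, hfS'⟩
  have hsm := fun T => hF.contDiffOn_planeExtend ht hms T
  have hinj : InjOn (planeExtend (F S)) unitSquare := by
    intro z hz w hw h
    obtain ⟨q, rfl⟩ := exists_eq_coe_of_mem_unitSquare hz
    obtain ⟨q', rfl⟩ := exists_eq_coe_of_mem_unitSquare hw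
    rw [planeExtend_coe, planeExtend_coe] at h
    rw [hF.injective S h]
  have hclosed : ∀ T, IsClosed (range (F T)) := fun T => by
    rw [← planeExtend_image_unitSquare]
    exact (isCompact_unitSquare.image_of_continuousOn (hsm T).continuousOn).isClosed
  have hI := hinj.leftInvOn_invFunOn
  have hg : ContDiffOn ℝ m (fun z : ℝ × ℝ => R z.1 * bspline (knot p r τ) p j z.2) unitSquare :=
    (hR.comp contDiffOn_fst fun z hz => hz.1).mul
      ((ht.contDiffOn_bspline hms j).comp contDiffOn_snd fun z hz => hz.2)
  rw [domain_eq_union F hS, ← planeExtend_image_unitSquare (F S)]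
  -- The vanishing factor is the coordinate `u`, and `B` is the other patch, which meets this one
  -- only where `u = 0`.
  refine contDiffOn_image_union uniqueDiffOn_unitSquare (u := Prod.fst) hI
    (continuousOn_of_leftInvOn_of_isCompact isCompact_unitSquare (hsm S).continuousOn hI)
    (planeExtend_image_unitSquare (F S) ▸ hclosed S) (hclosed S') ?_ ?_ m (hsm S) contDiffOn_fst hg
    ?_ ?_
  · intro z hz h
    obtain ⟨q, rfl⟩ := exists_eq_coe_of_mem_unitSquare hz
    rw [planeExtend_coe] at h
    simp [hF.fst_eq_zero hS h]
  · intro z hz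
    have hd := (((hsm S).differentiableOn (by exact_mod_cast (by omega : m ≠ 0))) z
      hz).hasFDerivWithinAt
    obtain ⟨q, rfl⟩ := exists_eq_coe_of_mem_unitSquare hz
    have hreg := hF.regular S q
    rw [Du_eq_of_hasFDerivWithinAt hd, Dv_eq_of_hasFDerivWithinAt hd] at hreg
    exact isInvertible_of_det_ne_zero _ hreg
  · intro z hz
    obtain ⟨q, rfl⟩ := exists_eq_coe_of_mem_unitSquare hz
    rw [planeExtend_coe, hfS, NN, N, N, hRi _ q.1.2, smul_eq_mul, mul_assoc]
  · rintro _ ⟨q, rfl⟩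
    exact hfS' q

/-- Univariate independence in `u` for each fixed `v`, then again in `v`. -/
theorem linearIndependent_NN {p r k : ℕ} (hr : r < p) {τ : Fin k → ℝ} (hτ : StrictMono τ)
    (hτ01 : ∀ m, 0 < τ m ∧ τ m < 1) :
    LinearIndependent ℝ
      fun x : Fin (p + 1 + k * (p - r)) × Fin (p + 1 + k * (p - r)) => NN p r τ x.1 x.2 := by
  have ht := isOpenKnots_knot hr hτ hτ01
  rw [Fintype.linearIndependent_iff]
  intro c hc x
  have h1 : ∀ v ∈ Icc (0 : ℝ) 1, (fun i => ∑ j, c (i, j) * bspline (knot p r τ) p j v) = 0 := by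
    intro v hv
    refine ht.linearIndependent_bspline (Nat.sub_le _ _) _ fun u hu => ?_
    have := congrFun hc (⟨u, hu⟩, ⟨v, hv⟩)
    simp only [Finset.sum_apply, Pi.smul_apply, NN, N, smul_eq_mul, Pi.zero_apply,
      Fintype.sum_prod_type] at this
    rw [← this]
    refine Finset.sum_congr rfl fun i _ => ?_
    rw [Finset.sum_mul]
    exact Finset.sum_congr rfl fun j _ => by ring
  have h2 : (fun j => c (x.1, j)) = 0 :=
    ht.linearIndependent_bspline (Nat.sub_le _ _) _ fun v hv => congrFun (h1 v hv) x.1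
  exact congrFun h2 x.2

instance : Fintype Side := ⟨{Side.L, Side.R}, fun S => by cases S <;> simp⟩

/-- The pullback to one patch, as a linear map on `𝒱₁²`. -/
def pullbackLinear (p r : ℕ) {k : ℕ} (τ : Fin k → ℝ)
    (F : Side → unitInterval × unitInterval → ℝ × ℝ) (S : Side) :
    isoSpaceOne p r τ F →ₗ[ℝ] unitInterval × unitInterval → ℝ where
  toFun φ := pullback F φ S
  map_add' _ _ := rfl
  map_smul' _ _ := rfl

theorem ext_pullback {F : Side → unitInterval × unitInterval → ℝ × ℝ} {φ ψ : domain F → ℝ}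
    (h : ∀ S, pullback F φ S = pullback F ψ S) : φ = ψ := by
  funext ⟨y, hy⟩
  rcases hy with ⟨q, rfl⟩ | ⟨q, rfl⟩
  · exact congrFun (h Side.L) q
  · exact congrFun (h Side.R) q

theorem IsTwoPatch.exists_mem_isoSpaceOne {p r k : ℕ} (hr : r < p) (h2r : 2 ≤ r)
    {τ : Fin k → ℝ} (hτ : StrictMono τ) (hτ01 : ∀ m, 0 < τ m ∧ τ m < 1)
    {F : Side → unitInterval × unitInterval → ℝ × ℝ} (hF : IsTwoPatch p r τ F) (S : Side)
    (i : {i : Fin (p + 1 + k * (p - r)) // 3 ≤ (i : ℕ)}) (j : Fin (p + 1 + k * (p - r))) :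
    ∃ φ : isoSpaceOne p r τ F, pullback F φ S = NN p r τ i j ∧
      ∀ S', S' ≠ S → pullback F φ S' = 0 := by
  classical
  obtain ⟨S₀, hS₀, hS'⟩ : ∃ S₀, S₀ ≠ S ∧ ∀ S', S' ≠ S → S' = S₀ := by
    cases S
    · exact ⟨Side.R, by simp, fun S' h => by cases S' <;> simp_all⟩
    · exact ⟨Side.L, by simp, fun S' h => by cases S' <;> simp_all⟩
  -- For `m = 2` the requirement `m + 1 ≤ i` is `3 ≤ i`, and `m ≤ r` is `2 ≤ r`.
  obtain ⟨f, hf, hfS, hfS'⟩ := hF.exists_contDiffOn (m := 2) hr (by norm_num) h2r hτ hτ01 hS₀ i j i.2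
  let φ : domain F → ℝ := fun y => f y
  have h1 : pullback F φ S = NN p r τ i j := funext hfS
  have h2 : ∀ S', S' ≠ S → pullback F φ S' = 0 := fun S' h => by
    rw [hS' S' h]; exact funext hfS'
  refine ⟨⟨φ, ⟨fun T => ?_, f, hf, fun _ => rfl⟩, fun T => ?_⟩, h1, h2⟩
  · by_cases h : T = S
    · rw [h, h1]; exact NN_mem_splineSpace₂ p r τ i j
    · rw [h2 T h]; exact zero_mem _
  · by_cases h : T = S
    · refine ⟨fun a b => if a = i ∧ b = j then 1 else 0, fun q => ?_, fun a b ha => ?_⟩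
      · rw [h, h1, Finset.sum_eq_single (i : Fin (p + 1 + k * (p - r))), Finset.sum_eq_single j]
        · simp
        · intro b _ hb; simp [hb]
        · simp
        · intro a _ ha; simp [ha]
        · simp
      · refine if_neg ?_
        rintro ⟨rfl, -⟩
        exact absurd i.2 (by omega)
    · exact ⟨fun _ _ => 0, fun q => by rw [h2 T h]; simp, fun _ _ _ => rfl⟩

theorem card_three_le (p m : ℕ) (hp : 2 ≤ p) :
    Fintype.card {i : Fin (p + 1 + m) // 3 ≤ (i : ℕ)} = p - 2 + m := by
  rw [← Fintype.card_fin (p - 2 + m)]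
  refine Fintype.card_congr ⟨fun i => ⟨i.1 - 3, by have := i.1.2; have := i.2; omega⟩,
    fun i => ⟨⟨i + 3, by omega⟩, by simp⟩, fun i => ?_, fun i => ?_⟩
  · ext; have := i.2; simp; omega
  · ext; simp

end Iso

/-! ### The basis and the dimension. -/

theorem lemma2 (p r k : ℕ) (hp : 5 ≤ p) (hr : 2 ≤ r) (hrp : r ≤ p - 3)
    (τ : Fin k → ℝ) (hτ : StrictMono τ) (hτ01 : ∀ m, 0 < τ m ∧ τ m < 1)
    (F : Iso.Side → unitInterval × unitInterval → ℝ × ℝ)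
    (hF : Iso.IsTwoPatch p r τ F) (hG : Iso.IsBilinearLikeG2 F) :
    Module.Finite ℝ (Iso.isoSpaceOne p r τ F) ∧
    Module.finrank ℝ (Iso.isoSpaceOne p r τ F)
      = 2 * (p - 2 + k * (p - r)) * (p + 1 + k * (p - r)) ∧
    ∃ φ : Module.Basis
        (Iso.Side × {i : Fin (p + 1 + k * (p - r)) // 3 ≤ (i : ℕ)} × Fin (p + 1 + k * (p - r)))
        ℝ (Iso.isoSpaceOne p r τ F),
      ∀ S i j,
        Iso.pullback F (φ (S, i, j)) S = Iso.NN p r τ i j ∧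
        ∀ S', S' ≠ S → Iso.pullback F (φ (S, i, j)) S' = 0 := by
  have hrp' : r < p := by omega
  choose v hv hv' using fun S i j => hF.exists_mem_isoSpaceOne hrp' hr hτ hτ01 S i j
  -- Pulling back to `S` removes every basis candidate of the other patch, so independence and
  -- spanning can be tested one patch at a time.
  have hsum : ∀ (c : Iso.Side × {i : Fin (p + 1 + k * (p - r)) // 3 ≤ (i : ℕ)} ×
      Fin (p + 1 + k * (p - r)) → ℝ) (S : Iso.Side),
      Iso.pullbackLinear p r τ F S (∑ x, c x • v x.1 x.2.1 x.2.2) =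
        ∑ y : {i : Fin (p + 1 + k * (p - r)) // 3 ≤ (i : ℕ)} × Fin (p + 1 + k * (p - r)),
          c (S, y) • Iso.NN p r τ y.1 y.2 := by
    intro c S
    rw [map_sum, Fintype.sum_prod_type, Finset.sum_eq_single S]
    · refine Finset.sum_congr rfl fun y _ => ?_
      rw [map_smul]
      exact congrArg _ (hv S y.1 y.2)
    · intro S' _ hS'
      refine Finset.sum_eq_zero fun y _ => ?_
      rw [map_smul]
      exact (congrArg _ (hv' S' y.1 y.2 S hS'.symm)).trans (smul_zero _)
    · simp
  have hli : LinearIndependent ℝ fun x : Iso.Side ×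
      {i : Fin (p + 1 + k * (p - r)) // 3 ≤ (i : ℕ)} × Fin (p + 1 + k * (p - r)) =>
        v x.1 x.2.1 x.2.2 := by
    rw [Fintype.linearIndependent_iff]
    rintro c hc ⟨S, y⟩
    have h := hsum c S
    rw [hc, map_zero] at h
    have hN := (Iso.linearIndependent_NN hrp' hτ hτ01).comp
      (fun y : {i : Fin (p + 1 + k * (p - r)) // 3 ≤ (i : ℕ)} × Fin (p + 1 + k * (p - r)) =>
        ((y.1 : Fin (p + 1 + k * (p - r))), y.2))
      (fun y y' h => Prod.ext (Subtype.ext (Prod.ext_iff.1 h).1) (Prod.ext_iff.1 h).2)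
    exact Fintype.linearIndependent_iff.1 hN (fun y => c (S, y)) h.symm y
  have hspan : ⊤ ≤ Submodule.span ℝ (Set.range fun x : Iso.Side ×
      {i : Fin (p + 1 + k * (p - r)) // 3 ≤ (i : ℕ)} × Fin (p + 1 + k * (p - r)) =>
        v x.1 x.2.1 x.2.2) := by
    intro φ _
    choose d hd hd0 using φ.2.2
    -- The given coefficients with `i ≥ 3` serve as coordinates; the terms with `i ≤ 2` drop out by
    -- membership in `𝒱₁²`.
    have hφ : φ = ∑ x : Iso.Side × {i : Fin (p + 1 + k * (p - r)) // 3 ≤ (i : ℕ)} ×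
        Fin (p + 1 + k * (p - r)), d x.1 x.2.1 x.2.2 • v x.1 x.2.1 x.2.2 := by
      refine Subtype.ext (Iso.ext_pullback fun S => ?_)
      refine Eq.trans ?_ (hsum (fun x => d x.1 x.2.1 x.2.2) S).symm
      funext q
      rw [hd S q, ← Fintype.sum_subtype_add_sum_subtype
        (fun i : Fin (p + 1 + k * (p - r)) => 3 ≤ (i : ℕ)),
        Finset.sum_eq_zero (s := (Finset.univ :
          Finset {i : Fin (p + 1 + k * (p - r)) // ¬ 3 ≤ (i : ℕ)})), add_zero]
      · simp only [Finset.sum_apply, Pi.smul_apply, smul_eq_mul, Fintype.sum_prod_type]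
      · intro i _
        refine Finset.sum_eq_zero fun j _ => ?_
        rw [hd0 S i j (by have := i.2; omega), zero_mul]
    rw [hφ]
    exact Submodule.sum_mem _ fun x _ => Submodule.smul_mem _ _ (Submodule.subset_span ⟨x, rfl⟩)
  let φ := Module.Basis.mk hli hspan
  refine ⟨Module.Finite.of_basis φ, ?_, φ, fun S i j => ?_⟩
  · rw [Module.finrank_eq_card_basis φ, Fintype.card_prod, Fintype.card_prod, Fintype.card_fin,
      Iso.card_three_le p _ (by omega), ← mul_assoc]
    rfl
  · have h : φ (S, i, j) = v S i j := Module.Basis.mk_apply hli hspan (S, i, j)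
    rw [h]
    exact ⟨hv S i j, hv' S i j⟩
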